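/- Let $d$ be a positive integer, let $q$ be a prime power with $(d,q)\notin\{(1,2),(1,3),(2,2)\}$, let $\mathbb{F}_q$ be the field with $q$ elements, and let $\operatorname{GL}_d(q)$ be the group of invertible $d\times d$ matrices over $\mathbb{F}_q$. Then every element of $\operatorname{GL}_d(q)$ is a product of two fixed-point-free elements of $\operatorname{GL}_d(q)$, that is, of two elements that act as derangements (permutations without fixed points) on $\mathbb{F}_q^d\setminus\{0\}$ in the natural action of $\operatorname{GL}_d(q)$, in which $M$ acts by $x\mapsto xM$ on row vectors. Here a matrix $M\in\operatorname{GL}_d(q)$ is called fixed-point-free if $xM\neq x$ for all $x\in\mathbb{F}_q^d\setminus\{0\}$. -/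

import Mathlib

open scoped Matrix MatrixGroups

namespace NaturalAction

variable {d : ℕ} {K : Type*} [Field K]

/-- An invertible matrix is fixed-point-free if it fixes no nonzero (row) vector. -/
def IsFixedPointFree (A : GL (Fin d) K) : Prop :=
  ∀ x : Fin d → K, x ≠ 0 → x ᵥ* (A : Matrix (Fin d) (Fin d) K) ≠ x

theorem vecMul_ne_zero (A : GL (Fin d) K) {x : Fin d → K} (hx : x ≠ 0) :
    x ᵥ* (A : Matrix (Fin d) (Fin d) K) ≠ 0 := by
  intro h
  apply hx
  have h2 : (x ᵥ* (A : Matrix (Fin d) (Fin d) K)) ᵥ*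
      ((A⁻¹ : GL (Fin d) K) : Matrix (Fin d) (Fin d) K) = x := by
    rw [Matrix.vecMul_vecMul, Units.mul_inv, Matrix.vecMul_one]
  rw [← h2, h, Matrix.zero_vecMul]

/-- The permutation `x ↦ x A` of the set of nonzero row vectors induced by an invertible
matrix `A`. -/
def perm (A : GL (Fin d) K) : Equiv.Perm {x : Fin d → K // x ≠ 0} where
  toFun x := ⟨x.1 ᵥ* (A : Matrix (Fin d) (Fin d) K), vecMul_ne_zero A x.2⟩
  invFun x := ⟨x.1 ᵥ* ((A⁻¹ : GL (Fin d) K) : Matrix (Fin d) (Fin d) K),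
    vecMul_ne_zero A⁻¹ x.2⟩
  left_inv x := by
    apply Subtype.ext
    simp only [Matrix.vecMul_vecMul]
    rw [Units.mul_inv, Matrix.vecMul_one]
  right_inv x := by
    apply Subtype.ext
    simp only [Matrix.vecMul_vecMul]
    rw [Units.inv_mul, Matrix.vecMul_one]

end NaturalAction

namespace Matrix

/-! In `A = B * (B⁻¹ * A)` both factors are fixed-point-free exactly when `B - 1` and `B - A` are
nonsingular, so such an invertible `B` is sought. Allowing singular `A` lets the induction pass to
diagonal blocks. In `hasAvoider_fromBlocks` a nonzero lower left block can repair the first diagonal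
block, whatever that block is, so only the last block needs an avoider. Scalar matrices are treated
apart. The first block has size 1 if some `b ≠ 0, 1` exists; over the field with two elements it has
size 2, and the base size is 3. -/

theorem fromBlocks_sub_fromBlocks {K m n : Type*} [AddGroup K] (A A' : Matrix m m K)
    (B B' : Matrix m n K) (C C' : Matrix n m K) (D D' : Matrix n n K) :
    fromBlocks A B C D - fromBlocks A' B' C' D' =
      fromBlocks (A - A') (B - B') (C - C') (D - D') := by
  simp only [sub_eq_add_neg, fromBlocks_neg, fromBlocks_add]

/-! ### Avoiders over a general field -/

section General

variable {K : Type*} [Field K] {m n : Type*} [Fintype m] [DecidableEq m] [Fintype n]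
  [DecidableEq n]

/-- There is a matrix whose differences with `0`, `1` and `A` are all nonsingular. -/
def HasAvoider (A : Matrix n n K) : Prop :=
  ∃ B : Matrix n n K, B.det ≠ 0 ∧ (B - 1).det ≠ 0 ∧ (B - A).det ≠ 0

theorem HasAvoider.of_conj {A P P' : Matrix n n K} (h : P * P' = 1)
    (hA : HasAvoider (P * A * P')) : HasAvoider A := by
  obtain ⟨B, h0, h1, h2⟩ := hA
  have h' : P' * P = 1 := mul_eq_one_comm.mp h
  have key : ∀ X : Matrix n n K, (P' * X * P).det = X.det := fun X ↦ by
    rw [det_mul, det_mul, mul_right_comm, ← det_mul, h', det_one, one_mul]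
  have hA' : P' * (P * A * P') * P = A := by
    rw [show P' * (P * A * P') * P = (P' * P) * A * (P' * P) by simp only [Matrix.mul_assoc], h']
    simp
  refine ⟨P' * B * P, by rwa [key], ?_, ?_⟩
  · rwa [← key (B - 1), Matrix.mul_sub, Matrix.sub_mul, Matrix.mul_one, h'] at h1
  · rwa [← key (B - P * A * P'), Matrix.mul_sub, Matrix.sub_mul, hA'] at h2

theorem HasAvoider.of_submatrix {A : Matrix n n K} (e : m ≃ n)
    (hA : HasAvoider (A.submatrix e e)) : HasAvoider A := by
  obtain ⟨B, h0, h1, h2⟩ := hA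
  refine ⟨B.submatrix e.symm e.symm, by rwa [det_submatrix_equiv_self], ?_, ?_⟩
  · rwa [← det_submatrix_equiv_self e.symm, submatrix_sub, Pi.sub_apply, Pi.sub_apply,
      submatrix_one_equiv] at h1
  · rwa [← det_submatrix_equiv_self e.symm, submatrix_sub, Pi.sub_apply, Pi.sub_apply,
      submatrix_submatrix, e.self_comp_symm, submatrix_id_id] at h2

theorem HasAvoider.of_map {L : Type*} [Field L] (φ : K ≃+* L) {A : Matrix n n K}
    (hA : HasAvoider (A.map φ)) : HasAvoider A := by
  obtain ⟨B, h0, h1, h2⟩ := hA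
  have key : ∀ X : Matrix n n L, X.det ≠ 0 → (X.map φ.symm).det ≠ 0 := fun X hX ↦ by
    have := RingEquiv.map_det φ.symm X
    rw [RingEquiv.mapMatrix_apply] at this
    rw [← this]
    simpa using hX
  refine ⟨B.map φ.symm, key _ h0, ?_, ?_⟩
  · convert key _ h1 using 2
    ext i j
    by_cases hij : i = j <;> simp [hij]
  · convert key _ h2 using 2
    ext i j
    simp

/-- A block triangular avoider, built from avoiders of the diagonal blocks up to a correction
by the lower left block. -/
theorem hasAvoider_fromBlocks {A₁ : Matrix m m K} {A₂ : Matrix m n K} {Q : Matrix n m K}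
    {A₄ : Matrix n n K} (B : Matrix m m K) (h0 : B.det ≠ 0) (h1 : (B - 1).det ≠ 0)
    (Z : Matrix m n K) (hZ : (B - A₁ + Z * Q).det ≠ 0) (h : HasAvoider A₄) :
    HasAvoider (fromBlocks A₁ A₂ Q A₄) := by
  obtain ⟨C, k0, k1, k2⟩ := h
  -- With this upper right block, the Schur complement of `C - A₄` is `B - A₁ + Z * Q`.
  refine ⟨fromBlocks B (A₂ + Z * (C - A₄)) 0 C, ?_, ?_, ?_⟩
  · rw [det_fromBlocks_zero₂₁]
    exact mul_ne_zero h0 k0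
  · rw [← fromBlocks_one, fromBlocks_sub_fromBlocks, sub_zero, sub_zero, det_fromBlocks_zero₂₁]
    exact mul_ne_zero h1 k1
  · rw [fromBlocks_sub_fromBlocks, add_sub_cancel_left]
    let _ := invertibleOfIsUnitDet (C - A₄) (isUnit_iff_ne_zero.mpr k2)
    rw [det_fromBlocks₂₂, Matrix.mul_assoc Z, mul_invOf_self, Matrix.mul_one, zero_sub,
      Matrix.mul_neg, sub_neg_eq_add]
    exact mul_ne_zero k2 hZ

theorem HasAvoider.fromBlocks_zero {A₁ : Matrix m m K} {A₄ : Matrix n n K}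
    (h₁ : HasAvoider A₁) (h₄ : HasAvoider A₄) : HasAvoider (fromBlocks A₁ 0 0 A₄) := by
  obtain ⟨B, h0, h1, h2⟩ := h₁
  exact hasAvoider_fromBlocks B h0 h1 0 (by simpa using h2) h₄

/-- Changing the complement of the first block adds `Q * Z` to the last block. -/
theorem HasAvoider.of_shear {A₁ : Matrix m m K} {A₂ : Matrix m n K} {Q : Matrix n m K}
    {A₄ : Matrix n n K} (Z : Matrix m n K)
    (h : ∀ (A₁' : Matrix m m K) (A₂' : Matrix m n K),
      HasAvoider (fromBlocks A₁' A₂' Q (A₄ + Q * Z))) :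
    HasAvoider (fromBlocks A₁ A₂ Q A₄) := by
  apply HasAvoider.of_conj (P := fromBlocks 1 (-Z) 0 1) (P' := fromBlocks 1 Z 0 1)
  · simp [fromBlocks_multiply]
  · simp only [fromBlocks_multiply, Matrix.one_mul, Matrix.zero_mul, zero_add, Matrix.mul_one,
      Matrix.mul_zero, add_zero]
    rw [add_comm (Q * Z)]
    exact h _ _

/-- Permuting indices moves a nonzero off-diagonal entry to any off-diagonal place. For a nonscalar
diagonal matrix, a transvection creates such an entry as the difference of two diagonal ones. -/
theorem HasAvoider.of_forall_apply_ne_zero {A : Matrix n n K} (hA : ∀ c : K, A ≠ c • 1)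
    {i₀ j₀ : n} (hij : i₀ ≠ j₀) (h : ∀ A' : Matrix n n K, A' i₀ j₀ ≠ 0 → HasAvoider A') :
    HasAvoider A := by
  have offdiag : ∀ A' : Matrix n n K, ∀ i j, i ≠ j → A' i j ≠ 0 → HasAvoider A' := by
    intro A' i j hne hA'
    set s := Equiv.swap i₀ i
    have hsj : i ≠ s j₀ := by
      rw [← Equiv.swap_apply_left i₀ i]
      exact s.injective.ne hij
    refine HasAvoider.of_submatrix (s.trans (Equiv.swap (s j₀) j)) (h _ ?_)
    rw [submatrix_apply, Equiv.trans_apply, Equiv.trans_apply, Equiv.swap_apply_left,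
      Equiv.swap_apply_left, Equiv.swap_apply_of_ne_of_ne hsj hne]
    exact hA'
  by_cases hd : ∃ i j, i ≠ j ∧ A i j ≠ 0
  · obtain ⟨i, j, hne, hA'⟩ := hd
    exact offdiag A i j hne hA'
  push Not at hd
  obtain ⟨i, hi⟩ : ∃ i, A i i ≠ A i₀ i₀ := by
    by_contra! hc
    refine hA (A i₀ i₀) ?_
    ext i j
    by_cases hne : i = j
    · subst hne
      simp [hc]
    · simp [hd i j hne, hne]
  have hne : i ≠ i₀ := fun h ↦ hi (by rw [h])
  apply HasAvoider.of_conj (P := transvection i i₀ 1) (P' := transvection i i₀ (-1))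
  · rw [transvection_mul_transvection_same i i₀ hne, add_neg_cancel, transvection_zero]
  · apply offdiag _ i i₀ hne
    rw [mul_transvection_apply_same, transvection_mul_apply_same, transvection_mul_apply_same,
      hd i i₀ hne, hd i₀ i hne.symm]
    simpa [sub_eq_zero, ← sub_eq_add_neg] using hi.symm

theorem smul_one_submatrix_finSumFinEquiv (k l : ℕ) (c : K) :
    (c • (1 : Matrix (Fin (k + l)) (Fin (k + l)) K)).submatrix finSumFinEquiv finSumFinEquiv =
      fromBlocks (c • 1) 0 0 (c • 1) := by
  rw [submatrix_smul, Pi.smul_apply, Pi.smul_apply, submatrix_one_equiv, ← fromBlocks_one,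
    fromBlocks_smul, smul_zero, smul_zero]

theorem HasAvoider.smul_one_add {k l : ℕ} {c : K}
    (hk : HasAvoider (c • (1 : Matrix (Fin k) (Fin k) K)))
    (hl : HasAvoider (c • (1 : Matrix (Fin l) (Fin l) K))) :
    HasAvoider (c • (1 : Matrix (Fin (k + l)) (Fin (k + l)) K)) := by
  apply HasAvoider.of_submatrix finSumFinEquiv
  rw [smul_one_submatrix_finSumFinEquiv]
  exact hk.fromBlocks_zero hl

theorem hasAvoider_of_ne_zero {b : K} (hb0 : b ≠ 0) (hb1 : b ≠ 1) {A : Matrix n n K}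
    (hA : (b • 1 - A).det ≠ 0) : HasAvoider A := by
  refine ⟨b • 1, by simp [hb0], ?_, hA⟩
  rw [show (b • 1 - 1 : Matrix n n K) = (b - 1) • 1 by rw [sub_smul, one_smul]]
  simp [sub_ne_zero.mpr hb1]

theorem hasAvoider_smul_one {b c : K} (hb0 : b ≠ 0) (hb1 : b ≠ 1) (hbc : b ≠ c) :
    HasAvoider (c • (1 : Matrix n n K)) := by
  apply hasAvoider_of_ne_zero hb0 hb1
  rw [← sub_smul]
  simp [sub_ne_zero.mpr hbc]

/-- If `b ≠ 0, 1`, then every matrix other than `b • 1` has an avoider. -/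
theorem hasAvoider_of_ne_smul_one {b : K} (hb0 : b ≠ 0) (hb1 : b ≠ 1) (d : ℕ)
    (A : Matrix (Fin d) (Fin d) K) (hA : A ≠ b • 1) : HasAvoider A := by
  induction d with
  | zero => exact absurd (Subsingleton.elim _ _) hA
  | succ d ih =>
    by_cases hs : ∃ c : K, A = c • 1
    · obtain ⟨c, rfl⟩ := hs
      exact hasAvoider_smul_one hb0 hb1 fun h ↦ hA (by rw [h])
    push Not at hs
    obtain _ | d := d
    · refine absurd ?_ (hs (A 0 0))
      ext i j
      fin_cases i
      fin_cases j
      simp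
    apply HasAvoider.of_forall_apply_ne_zero hs (i₀ := 1) (j₀ := 0) (by simp)
    intro A' hA'
    apply HasAvoider.of_submatrix ((finSumFinEquiv (m := 1)).trans (finCongr (add_comm 1 (d + 1))))
    set M := A'.submatrix ((finSumFinEquiv (m := 1)).trans (finCongr (add_comm 1 (d + 1))))
      ((finSumFinEquiv (m := 1)).trans (finCongr (add_comm 1 (d + 1))))
    have hQ : M.toBlocks₂₁ 0 0 ≠ 0 := hA'
    clear_value M
    rw [← fromBlocks_toBlocks M]
    set Q := M.toBlocks₂₁
    have step : ∀ A₁ A₂ A₄, A₄ ≠ b • 1 → HasAvoider (fromBlocks A₁ A₂ Q A₄) := by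
      intro A₁ A₂ A₄ h₄
      refine hasAvoider_fromBlocks (b • 1) (by simp [hb0]) ?_
        -- This `Z` makes the 1×1 Schur complement equal to 1.
        (single 0 0 ((Q 0 0)⁻¹ * (1 - (b • 1 - A₁) 0 0))) ?_ (ih A₄ h₄)
      · simpa [sub_ne_zero] using hb1
      · rw [det_fin_one, add_apply, single_mul_apply_same, mul_right_comm, inv_mul_cancel₀ hQ]
        simp
    by_cases h₄ : M.toBlocks₂₂ = b • 1
    · apply HasAvoider.of_shear (single 0 0 1)
      intro A₁' A₂'
      apply step
      rw [h₄]
      intro h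
      have := congrFun (congrFun h 0) 0
      rw [add_apply, mul_single_apply_same, mul_one, add_eq_left] at this
      exact hQ this
    · exact step _ _ _ h₄

end General

/-! ### The field with two elements -/

section Two

/-- The witnesses have characteristic polynomial `t² + t + 1`, which has no roots. Trace 1 turns `(x
- a) * (1 + x - d)` into `(x - a)²`, which takes both values as `x` varies. -/
theorem hasAvoider_two_of_trace (A : Matrix (Fin 2) (Fin 2) (ZMod 2)) (hA : A.trace = 1) :
    HasAvoider A := by
  have key : ∀ a b c d : ZMod 2, a + d = 1 → ∃ x : ZMod 2,
      (x - a) * (1 + x - d) - (1 - b) * (1 - c) ≠ 0 := by decide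
  obtain ⟨x, hx⟩ := key (A 0 0) (A 0 1) (A 1 0) (A 1 1) (by rwa [trace_fin_two] at hA)
  refine ⟨!![x, 1; 1, 1 + x], ?_, ?_, ?_⟩
  · rw [det_fin_two]
    clear hx
    revert x
    decide
  · rw [det_fin_two]
    clear hx
    revert x
    decide
  · rw [det_fin_two]
    simpa using hx

theorem hasAvoider_two_smul_one (c : ZMod 2) :
    HasAvoider (c • (1 : Matrix (Fin 2) (Fin 2) (ZMod 2))) := by
  refine ⟨!![0, 1; 1, 1], ?_, ?_, ?_⟩ <;> rw [det_fin_two] <;> revert c <;> decide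

/-- Ten matrices without eigenvalues suffice for all 512 choices of `A`, by a finite check. -/
theorem hasAvoider_two_fin_three (A : Matrix (Fin 3) (Fin 3) (ZMod 2)) : HasAvoider A := by
  have key : ∀ a b c d e f g h i : ZMod 2, ∃ B ∈ ([
      !![0, 0, 1; 0, 1, 1; 1, 1, 0], !![0, 1, 0; 1, 0, 1; 1, 0, 0], !![0, 1, 1; 1, 1, 1; 0, 1, 0],
      !![1, 0, 1; 1, 0, 0; 0, 1, 1], !![0, 0, 1; 1, 0, 0; 0, 1, 1], !![0, 1, 0; 1, 1, 1; 1, 1, 0],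
      !![0, 1, 0; 0, 0, 1; 1, 1, 0], !![1, 0, 1; 1, 1, 0; 1, 1, 1], !![0, 0, 1; 0, 1, 1; 1, 1, 1],
      !![0, 0, 1; 1, 0, 0; 1, 1, 0]] : List (Matrix (Fin 3) (Fin 3) (ZMod 2))),
      (B 0 0 - a) * ((B 1 1 - e) * (B 2 2 - i) - (B 1 2 - f) * (B 2 1 - h))
        - (B 0 1 - b) * ((B 1 0 - d) * (B 2 2 - i) - (B 1 2 - f) * (B 2 0 - g))
        + (B 0 2 - c) * ((B 1 0 - d) * (B 2 1 - h) - (B 1 1 - e) * (B 2 0 - g)) ≠ 0 := by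
    decide +kernel
  obtain ⟨B, hB, h⟩ := key (A 0 0) (A 0 1) (A 0 2) (A 1 0) (A 1 1) (A 1 2) (A 2 0) (A 2 1) (A 2 2)
  refine ⟨B, ?_, ?_, ?_⟩
  · rw [det_fin_three]
    clear h
    revert B
    decide +kernel
  · rw [det_fin_three]
    clear h
    revert B
    decide +kernel
  · rw [det_fin_three]
    simp only [sub_apply]
    convert h using 1
    ring

/-- A rank-one correction `Z * Q`, built from one nonzero row of `Q`, already makes the 2×2 Schur
complement nonsingular. -/
theorem hasAvoider_two_fromBlocks {k : ℕ} {A₁ : Matrix (Fin 2) (Fin 2) (ZMod 2)}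
    {A₂ : Matrix (Fin 2) (Fin k) (ZMod 2)} {Q : Matrix (Fin k) (Fin 2) (ZMod 2)}
    {A₄ : Matrix (Fin k) (Fin k) (ZMod 2)} {i : Fin k} (hQ : Q i 0 ≠ 0) (h : HasAvoider A₄) :
    HasAvoider (fromBlocks A₁ A₂ Q A₄) := by
  have key : ∀ a b c d s t : ZMod 2, s ≠ 0 → ∃ x y z : ZMod 2,
      (x - a + y * s) * (1 + x - d + z * t) - (1 - b + y * t) * (1 - c + z * s) ≠ 0 := by decide
  obtain ⟨x, y, z, hx⟩ := key (A₁ 0 0) (A₁ 0 1) (A₁ 1 0) (A₁ 1 1) (Q i 0) (Q i 1) hQ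
  refine hasAvoider_fromBlocks !![x, 1; 1, 1 + x] ?_ ?_ (vecMulVec ![y, z] (Pi.single i 1)) ?_ h
  · rw [det_fin_two]
    clear hx
    revert x
    decide
  · rw [det_fin_two]
    clear hx
    revert x
    decide
  · rw [det_fin_two, vecMulVec_mul, single_one_vecMul]
    simp only [add_apply, sub_apply, vecMulVec_apply, row_apply]
    simpa using hx

/-- Over the field with two elements, every square matrix of size at least three has an
avoider. -/
theorem hasAvoider_two (n : ℕ) (hn : 3 ≤ n) (A : Matrix (Fin n) (Fin n) (ZMod 2)) :
    HasAvoider A := by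
  induction n using Nat.strong_induction_on with
  | _ n ih =>
    obtain rfl | ⟨k, rfl, hk⟩ : n = 3 ∨ ∃ k, n = 2 + (k + 1) ∧ 1 ≤ k := by
      rcases hn.eq_or_lt with h | h
      · exact .inl h.symm
      · exact .inr ⟨n - 3, by omega, by omega⟩
    · exact hasAvoider_two_fin_three A
    by_cases hs : ∃ c : ZMod 2, A = c • 1
    · obtain ⟨c, rfl⟩ := hs
      apply (hasAvoider_two_smul_one c).smul_one_add
      obtain rfl | hk := hk.eq_or_lt
      · exact hasAvoider_two_smul_one c
      · exact ih _ (by omega) (by omega) _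
    push Not at hs
    apply HasAvoider.of_submatrix finSumFinEquiv
    apply HasAvoider.of_forall_apply_ne_zero (i₀ := .inr 0) (j₀ := .inl 0) ?_ (by simp)
    · intro M hQ
      rw [← fromBlocks_toBlocks M]
      have hQ' : M.toBlocks₂₁ 0 0 ≠ 0 := hQ
      obtain rfl | hk := hk.eq_or_lt
      -- Not every 2×2 block has an avoider; the shear gives this one trace 1.
      · apply HasAvoider.of_shear (single 0 0 (1 - M.toBlocks₂₂.trace))
        intro A₁' A₂'
        apply hasAvoider_two_fromBlocks hQ'
        apply hasAvoider_two_of_trace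
        have h1 : M.toBlocks₂₁ 0 0 = 1 := (by decide : ∀ x : ZMod 2, x ≠ 0 → x = 1) _ hQ'
        rw [trace_add, trace_mul_single, h1]
        simp
      · exact hasAvoider_two_fromBlocks hQ' (ih _ (by omega) (by omega) _)
    · intro c hc
      apply hs c
      rw [← fromBlocks_one, fromBlocks_smul, smul_zero, smul_zero,
        ← smul_one_submatrix_finSumFinEquiv] at hc
      simpa using congrArg (fun X ↦ X.submatrix finSumFinEquiv.symm finSumFinEquiv.symm) hc

end Two

/-- Over the field with three elements, scalar matrices of size at least two have avoiders. -/
theorem hasAvoider_three_smul_one (c : ZMod 3) (n : ℕ) (hn : 2 ≤ n) :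
    HasAvoider (c • (1 : Matrix (Fin n) (Fin n) (ZMod 3))) := by
  -- The witnesses in sizes 2 and 3 have characteristic polynomials `t² + 1` and `t³ - t - 1`,
  -- without roots modulo 3.
  have h2 : HasAvoider (c • (1 : Matrix (Fin 2) (Fin 2) (ZMod 3))) := by
    refine ⟨!![0, 1; -1, 0], ?_, ?_, ?_⟩ <;> rw [det_fin_two] <;> revert c <;> decide
  have h3 : HasAvoider (c • (1 : Matrix (Fin 3) (Fin 3) (ZMod 3))) := by
    refine ⟨!![0, 0, 1; 1, 0, 1; 0, 1, 0], ?_, ?_, ?_⟩ <;> rw [det_fin_three] <;> clear h2 <;>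
      revert c <;> decide
  induction n using Nat.strong_induction_on with
  | _ n ih =>
    obtain rfl | rfl | hn' : n = 2 ∨ n = 3 ∨ 4 ≤ n := by omega
    · exact h2
    · exact h3
    · obtain ⟨k, rfl⟩ := Nat.exists_eq_add_of_le hn
      exact h2.smul_one_add (ih k (by omega) (by omega))

theorem hasAvoider_of_finite {K : Type*} [Field K] [Finite K] (d : ℕ) (hd : 0 < d)
    (h12 : (d, Nat.card K) ≠ (1, 2)) (h13 : (d, Nat.card K) ≠ (1, 3))
    (h22 : (d, Nat.card K) ≠ (2, 2)) (A : Matrix (Fin d) (Fin d) K) : HasAvoider A := by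
  have := Fintype.ofFinite K
  rw [Nat.card_eq_fintype_card] at h12 h13 h22
  have hK : 1 < Fintype.card K := Fintype.one_lt_card
  obtain h | h | h : Fintype.card K = 2 ∨ Fintype.card K = 3 ∨ 4 ≤ Fintype.card K := by omega
  · rw [h] at h12 h22
    apply HasAvoider.of_map (ZMod.ringEquivOfPrime K Nat.prime_two h).symm
    refine hasAvoider_two d ?_ _
    simp only [ne_eq, Prod.mk.injEq, and_true] at h12 h22
    omega
  · rw [h] at h13
    apply HasAvoider.of_map (ZMod.ringEquivOfPrime K Nat.prime_three h).symm
    simp only [ne_eq, Prod.mk.injEq, and_true] at h13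
    set M := A.map (ZMod.ringEquivOfPrime K Nat.prime_three h).symm
    by_cases hM : M = (2 : ZMod 3) • 1
    · rw [hM]
      exact hasAvoider_three_smul_one _ d (by omega)
    · exact hasAvoider_of_ne_smul_one (by decide) (by decide) d M hM
  · classical
    have avoid : ∀ a : K, ∃ b : K, b ≠ 0 ∧ b ≠ 1 ∧ b ≠ a := fun a ↦ by
      obtain ⟨b, -, hb⟩ := Finset.exists_mem_notMem_of_card_lt_card
        (s := {0, 1, a}) (t := (Finset.univ : Finset K))
        (Finset.card_le_three.trans_lt (by rw [Finset.card_univ]; omega))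
      exact ⟨b, by simpa using hb⟩
    obtain ⟨b, hb0, hb1, -⟩ := avoid 0
    by_cases hA : A = b • 1
    · obtain ⟨b', h0, h1, hb⟩ := avoid b
      rw [hA]
      exact hasAvoider_smul_one h0 h1 hb
    · exact hasAvoider_of_ne_smul_one hb0 hb1 d A hA

end Matrix

/-! ### From avoiders to derangements -/

namespace NaturalAction

theorem eq_zero_of_vecMul_eq_vecMul {n K : Type*} [Fintype n] [DecidableEq n] [Field K]
    {M N : Matrix n n K} (h : (M - N).det ≠ 0) {x : n → K} (hx : x ᵥ* M = x ᵥ* N) : x = 0 :=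
  Matrix.eq_zero_of_vecMul_eq_zero h (by rw [Matrix.vecMul_sub, hx, sub_self])

theorem IsFixedPointFree.perm_mem_derangements {d : ℕ} {K : Type*} [Field K] {A : GL (Fin d) K}
    (hA : IsFixedPointFree A) : perm A ∈ derangements {x : Fin d → K // x ≠ 0} :=
  fun x hx ↦ hA x.1 x.2 (Subtype.ext_iff.mp hx)

theorem exists_eq_mul_of_hasAvoider {d : ℕ} {K : Type*} [Field K] {A : GL (Fin d) K}
    (hA : (A : Matrix (Fin d) (Fin d) K).HasAvoider) :
    ∃ B C : GL (Fin d) K, A = B * C ∧ IsFixedPointFree B ∧ IsFixedPointFree C := by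
  obtain ⟨B, h0, h1, h2⟩ := hA
  lift B to GL (Fin d) K using (Matrix.isUnit_iff_isUnit_det B).mpr (isUnit_iff_ne_zero.mpr h0)
  -- If `B⁻¹ * A` fixes `x`, then `B` and `A` both send `x ᵥ* B⁻¹` to `x`.
  refine ⟨B, B⁻¹ * A, (mul_inv_cancel_left B A).symm, fun x hx hfix ↦ hx ?_,
    fun x hx hfix ↦ vecMul_ne_zero B⁻¹ hx ?_⟩
  · exact eq_zero_of_vecMul_eq_vecMul h1 (by rw [hfix, Matrix.vecMul_one])
  · apply eq_zero_of_vecMul_eq_vecMul h2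
    rw [Units.val_mul, ← Matrix.vecMul_vecMul] at hfix
    rw [hfix, Matrix.vecMul_vecMul, Units.inv_mul, Matrix.vecMul_one]

end NaturalAction

theorem proposition3p2 (d q : ℕ) (hd : 0 < d) (K : Type*) [Field K] [Finite K]
    (hq : Nat.card K = q)
    (h12 : (d, q) ≠ (1, 2)) (h13 : (d, q) ≠ (1, 3)) (h22 : (d, q) ≠ (2, 2))
    (A : GL (Fin d) K) :
    ∃ B C : GL (Fin d) K, A = B * C ∧
      (NaturalAction.IsFixedPointFree B ∧ NaturalAction.IsFixedPointFree C) ∧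
      (NaturalAction.perm B ∈ derangements {x : Fin d → K // x ≠ 0} ∧
        NaturalAction.perm C ∈ derangements {x : Fin d → K // x ≠ 0}) := by
  obtain ⟨B, C, h, hB, hC⟩ := NaturalAction.exists_eq_mul_of_hasAvoider
    (Matrix.hasAvoider_of_finite d hd (hq ▸ h12) (hq ▸ h13) (hq ▸ h22) A.1)
  exact ⟨B, C, h, ⟨hB, hC⟩, hB.perm_mem_derangements, hC.perm_mem_derangements⟩
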